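/- Let $B$ and $Q$ be real $n\times n$ matrices, with $Q$ symmetric positive semidefinite. Write $\cdot$ and $|\cdot|$ for the Euclidean scalar product and norm of $\mathbb R^n$, and $\langle\xi\rangle=\sqrt{1+|\xi|^2}$. Assume that there exist an integer $r\ge 1$, an open set $\Omega_0\subset\mathbb R^n$ and a constant $c_0>0$ such that $$\forall \xi\in\Omega_0,\qquad \sum_{j=0}^{r}\big|Q(B^T)^j\xi\big|^2\ \ge\ c_0|\xi|^2 .$$ Let $\lambda_0>0$ and let $q_0,\dots,q_{r-1}\in[0,1]$ and $s_0,\dots,s_{r-1}\ge 0$ be real numbers such that $q_j=s_j=0$ for $0\le j\le r-3$ and, if $r\ge2$, $q_{r-2}\le q_{r-1}$ and $s_{r-2}\le s_{r-1}$. Define positive real numbers $\lambda_1,\dots,\lambda_r$ recursively by $$\lambda_{j+1}\Big(\frac{1-q_j}{\lambda_j}+1\Big)=1+s_j,\qquad 0\le j\le r-1 .$$ Assume that the family $(\lambda_0,\dots,\lambda_r)$ is (strictly) decreasing and, when $r\ge2$, that $$\frac{\lambda_{j-1}}{\lambda_{j-2}}+\frac{\lambda_{j-1}}{\lambda_j}\le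 2,\qquad 2\le j\le r .$$ Then there exist constants $c_1,c_2,c_3>0$ and a real-valued function $g\in C^\infty(\mathbb R^n)$ such that, for all $\xi\in\Omega_0$, $$|g(\xi)|\le c_1\sum_{j=0}^{r-1}\langle Q(B^T)^j\xi\rangle^{q_j}\langle\xi\rangle^{s_j}$$ and $$\langle\xi\rangle^{\lambda_r}\le c_2\langle Q\xi\rangle^{\lambda_0}+c_3\,B^T\xi\cdot\nabla g(\xi).$$ -/

import Mathlib

open scoped ContDiff Gradient

/-- The Japanese bracket `⟨x⟩ = √(1 + |x|²)`. -/
noncomputable def japaneseBracket {n : ℕ} (x : EuclideanSpace ℝ (Fin n)) : ℝ :=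
  Real.sqrt (1 + ‖x‖ ^ 2)

/-- The vector `A ξ` of `ℝⁿ` with its Euclidean structure. -/
noncomputable def matVec {n : ℕ} (A : Matrix (Fin n) (Fin n) ℝ)
    (ξ : EuclideanSpace ℝ (Fin n)) : EuclideanSpace ℝ (Fin n) :=
  WithLp.toLp 2 (A.mulVec ξ.ofLp)

/-!
The proof builds `g` from explicit global multipliers, without cutoff functions.

Write `⟨·⟩` for the Japanese bracket, `Q_k = Q (Bᵀ)ᵏ ξ`, and `X = Bᵀξ · ∇`, so that
`X Q_k = Q_{k+1}`. Put `ν = λ_r` and `w_k = λ_r / λ_k` for `k ≤ r`, `w_k = 1` for `k ≥ r`. The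
sequence `w` is nondecreasing because `λ` is decreasing, it is concave because of the hypothesis on
the ratios of the `λ_j` (`antitone_normalizedWeight_sub`), and the recursion for `λ` reads
`ν = (1 + s_j) w_{j+1} - (1 - q_j) w_j`.

For `j < r` let `U_j = ⟨ξ⟩ + ∑_{j ≤ k < r} ⟨Q_k⟩^{1 / w_k}` (`anisotropicWeight`). Then
`⟨Q_k⟩ ≲ U_j^{w_k}` for `j ≤ k ≤ r + 1`, and since the increments of `w` decrease, `X` raises the
order of `U_j` by at most the first of them: `|X U_j| ≲ U_j^{1 + w_{j+1} - w_j}`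
(`exists_lineDeriv_anisotropicWeight_le`). The elementary multiplier is
`g_j = (Q_j · Q_{j+1}) ⟨Q_{j+1}⟩ᵃ U_j^{-b}` with `a = max (s_j - 1) 0` and
`b = (1 + a - s_j) w_{j+1} + (1 - q_j) w_j`. These exponents make `g_j` no larger than
`⟨Q_j⟩^{q_j} ⟨ξ⟩^{s_j}` (`exists_abs_multiplier_le`), while the term `|Q_{j+1}|²` of
`X (Q_j · Q_{j+1})` contributes to `X g_j` a quantity of size `U_j^ν` where `⟨Q_{j+1}⟩` is
comparable to `U_j^{w_{j+1}}`. All other terms contain the factor `Q_j` and are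
`O(⟨Q_j⟩ U_j^{ν - w_j})` (`exists_bracket_rpow_le_fderiv_multiplier`). Hence, for every `δ > 0`,
`⟨Q_{j+1}⟩^{λ_{j+1}} ≤ M X g_j + N ⟨Q_j⟩^{λ_j} + δ U_j^ν` (`exists_bracket_rpow_succ_le`).

Let `E = ⟨ξ⟩^{λ_r} + ∑_{k < r} ⟨Q_k⟩^{λ_k}`, which dominates every `U_j^ν`. On `Ω₀` the lower bound
on `∑ |Q_k|²` gives `E ≲ ∑_{k ≤ r} ⟨Q_k⟩^{λ_k}`. Adding a large multiple of
`g_{r-1}, …, g_0` in turn removes the terms of index `r, …, 1` from the right-hand side, the error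
`δ U_j^ν` being absorbed by `E` (`exists_global_multiplier`). What is left is
`E ≲ ⟨Q_0⟩^{λ_0} + X g`.
-/

open Finset

/-! ### The Japanese bracket -/

section Bracket

variable {n : ℕ}

theorem japaneseBracket_sq (x : EuclideanSpace ℝ (Fin n)) :
    japaneseBracket x ^ 2 = 1 + ‖x‖ ^ 2 :=
  Real.sq_sqrt (by positivity)

theorem one_le_japaneseBracket (x : EuclideanSpace ℝ (Fin n)) : 1 ≤ japaneseBracket x :=
  Real.one_le_sqrt.2 (by nlinarith [sq_nonneg ‖x‖])

theorem japaneseBracket_pos (x : EuclideanSpace ℝ (Fin n)) : 0 < japaneseBracket x :=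
  one_pos.trans_le (one_le_japaneseBracket x)

theorem norm_le_japaneseBracket (x : EuclideanSpace ℝ (Fin n)) : ‖x‖ ≤ japaneseBracket x :=
  Real.le_sqrt_of_sq_le (by linarith)

theorem japaneseBracket_clm_le
    (L : EuclideanSpace ℝ (Fin n) →L[ℝ] EuclideanSpace ℝ (Fin n))
    (x : EuclideanSpace ℝ (Fin n)) :
    japaneseBracket (L x) ≤ (1 + ‖L‖) * japaneseBracket x := by
  have hJ := (japaneseBracket_pos x).le
  refine Real.sqrt_le_iff.2 ⟨by positivity, ?_⟩
  rw [mul_pow, japaneseBracket_sq]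
  have h : ‖L x‖ ^ 2 ≤ (‖L‖ * ‖x‖) ^ 2 := by gcongr; exact L.le_opNorm x
  nlinarith [norm_nonneg L, mul_nonneg (norm_nonneg L) (sq_nonneg ‖x‖), sq_nonneg ‖x‖,
    sq_nonneg ‖L‖]

theorem contDiff_japaneseBracket :
    ContDiff ℝ ∞ (japaneseBracket : EuclideanSpace ℝ (Fin n) → ℝ) :=
  ContDiff.sqrt (contDiff_const.add (contDiff_norm_sq ℝ)) fun x => by positivity

/-- The factor `⟨L ξ⟩^{p-1}` of the chain rule and the `⟨L ξ⟩⁻¹` from the gradient of the bracket are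
merged into `⟨L ξ⟩^{p-2}`. -/
theorem hasLineDerivAt_japaneseBracket_clm_rpow
    (L : EuclideanSpace ℝ (Fin n) →L[ℝ] EuclideanSpace ℝ (Fin n))
    (ξ v : EuclideanSpace ℝ (Fin n)) (p : ℝ) :
    HasLineDerivAt ℝ (fun ξ => japaneseBracket (L ξ) ^ p)
      (inner ℝ (L ξ) (L v) * p * japaneseBracket (L ξ) ^ (p - 2)) ξ v := by
  have hJ := japaneseBracket_pos (L ξ)
  have hL : HasDerivAt (fun t : ℝ => L (ξ + t • v)) (L v) 0 := by
    have : HasDerivAt (fun t : ℝ => L ξ + t • L v) ((1 : ℝ) • L v) 0 :=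
      ((hasDerivAt_id (0 : ℝ)).smul_const (L v)).const_add (L ξ)
    simpa using this
  have h1 := (hL.norm_sq.const_add 1).sqrt (by positivity)
  have h2 := h1.rpow_const (p := p) (Or.inl (by simpa using (Real.sqrt_pos.2 (by positivity)).ne'))
  unfold HasLineDerivAt
  refine h2.congr_deriv ?_
  simp only [zero_smul, add_zero]
  change 2 * inner ℝ (L ξ) (L v) / (2 * japaneseBracket (L ξ)) * p
    * japaneseBracket (L ξ) ^ (p - 1) = _
  rw [show p - 1 = (p - 2) + 1 by ring, Real.rpow_add_one hJ.ne']
  field_simp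

theorem abs_inner_mul_bracket_le (x y : EuclideanSpace ℝ (Fin n)) {p : ℝ} (hp : 0 ≤ p) :
    |inner ℝ x y * p * japaneseBracket x ^ (p - 2)|
      ≤ p * japaneseBracket x ^ (p - 1) * ‖y‖ := by
  have hJ := japaneseBracket_pos x
  have hJp : 0 < japaneseBracket x ^ (p - 2) := Real.rpow_pos_of_pos hJ _
  rw [abs_mul, abs_mul, abs_of_nonneg hp, abs_of_pos hJp, show p - 1 = (p - 2) + 1 by ring,
    Real.rpow_add_one hJ.ne']
  have h : |inner ℝ x y| ≤ japaneseBracket x * ‖y‖ :=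
    (abs_real_inner_le_norm x y).trans (by gcongr; exact norm_le_japaneseBracket x)
  calc _ ≤ (japaneseBracket x * ‖y‖) * p * japaneseBracket x ^ (p - 2) := by gcongr
    _ = _ := by ring

end Bracket

/-! ### The anisotropic weight -/

section Weight

variable {n : ℕ} (L : ℕ → EuclideanSpace ℝ (Fin n) →L[ℝ] EuclideanSpace ℝ (Fin n))
  (A : EuclideanSpace ℝ (Fin n) →L[ℝ] EuclideanSpace ℝ (Fin n)) (w : ℕ → ℝ) (r j : ℕ)

/-- The weight `U_j(ξ) = ⟨ξ⟩ + ∑_{j ≤ k < r} ⟨L_k ξ⟩^{1 / w_k}` attached to a chain `L` of linear maps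
and exponents `w`. The terms with `k < j` are left out: differentiating them along the flow would
raise the order by more than `w_{j+1} - w_j`. -/
noncomputable def anisotropicWeight (ξ : EuclideanSpace ℝ (Fin n)) : ℝ :=
  japaneseBracket ξ + ∑ k ∈ Ico j r, japaneseBracket (L k ξ) ^ (w k)⁻¹

theorem japaneseBracket_le_anisotropicWeight (ξ : EuclideanSpace ℝ (Fin n)) :
    japaneseBracket ξ ≤ anisotropicWeight L w r j ξ :=
  le_add_of_nonneg_right <| sum_nonneg fun _ _ =>
    (Real.rpow_pos_of_pos (japaneseBracket_pos _) _).le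

theorem one_le_anisotropicWeight (ξ : EuclideanSpace ℝ (Fin n)) :
    1 ≤ anisotropicWeight L w r j ξ :=
  (one_le_japaneseBracket ξ).trans (japaneseBracket_le_anisotropicWeight L w r j ξ)

theorem anisotropicWeight_pos (ξ : EuclideanSpace ℝ (Fin n)) :
    0 < anisotropicWeight L w r j ξ :=
  one_pos.trans_le (one_le_anisotropicWeight L w r j ξ)

theorem contDiff_anisotropicWeight : ContDiff ℝ ∞ (anisotropicWeight L w r j) :=
  contDiff_japaneseBracket.add <| ContDiff.sum fun k _ =>
    (contDiff_japaneseBracket.comp (L k).contDiff).rpow_const_of_ne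
      fun ξ => (japaneseBracket_pos (L k ξ)).ne'

variable {w r j}

theorem japaneseBracket_le_anisotropicWeight_rpow (hw : ∀ k, 0 < w k) {k : ℕ} (hjk : j ≤ k)
    (hkr : k < r) (ξ : EuclideanSpace ℝ (Fin n)) :
    japaneseBracket (L k ξ) ≤ anisotropicWeight L w r j ξ ^ w k := by
  have hJ := japaneseBracket_pos (L k ξ)
  rw [← Real.rpow_inv_le_iff_of_pos hJ.le (anisotropicWeight_pos L w r j ξ).le (hw k)]
  have : japaneseBracket (L k ξ) ^ (w k)⁻¹ ≤ ∑ k ∈ Ico j r, japaneseBracket (L k ξ) ^ (w k)⁻¹ :=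
    single_le_sum (f := fun k => japaneseBracket (L k ξ) ^ (w k)⁻¹)
      (fun k _ => (Real.rpow_pos_of_pos (japaneseBracket_pos (L k ξ)) _).le)
      (mem_Ico.2 ⟨hjk, hkr⟩)
  unfold anisotropicWeight
  linarith [japaneseBracket_pos ξ]

/-- The indices `r` and `r + 1`, which do not occur in the sum defining the weight, are covered by
the term `⟨ξ⟩`, since `w r = w (r + 1) = 1`. -/
theorem exists_japaneseBracket_le_anisotropicWeight_rpow (hw : ∀ k, 0 < w k)
    (hw1 : ∀ k, r ≤ k → w k = 1) :
    ∃ K : ℝ, 1 ≤ K ∧ ∀ k, j ≤ k → k ≤ r + 1 → ∀ ξ,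
      japaneseBracket (L k ξ) ≤ K * anisotropicWeight L w r j ξ ^ w k := by
  refine ⟨1 + ‖L r‖ + ‖L (r + 1)‖, by linarith [norm_nonneg (L r), norm_nonneg (L (r + 1))],
    fun k hjk hkr ξ => ?_⟩
  have hU := anisotropicWeight_pos L w r j ξ
  have h0 := norm_nonneg (L r)
  have h1 := norm_nonneg (L (r + 1))
  rcases lt_or_ge k r with hk | hk
  · have hUw := Real.rpow_pos_of_pos hU (w k)
    nlinarith [japaneseBracket_le_anisotropicWeight_rpow L hw hjk hk ξ]
  · rw [hw1 k hk, Real.rpow_one]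
    have hnorm : ‖L k‖ ≤ ‖L r‖ + ‖L (r + 1)‖ := by
      obtain rfl | rfl : k = r ∨ k = r + 1 := by omega
      · linarith
      · linarith
    have hJ := japaneseBracket_pos ξ
    calc japaneseBracket (L k ξ) ≤ (1 + ‖L k‖) * japaneseBracket ξ := japaneseBracket_clm_le _ _
      _ ≤ (1 + ‖L r‖ + ‖L (r + 1)‖) * anisotropicWeight L w r j ξ := by
        exact mul_le_mul (by linarith) (japaneseBracket_le_anisotropicWeight L w r j ξ) hJ.le
          (by positivity)

/-- Differentiating `⟨L_k ξ⟩^{1 / w_k}` along `A ξ` replaces one factor `⟨L_k ξ⟩` by `L_{k+1} ξ`, which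
raises the order by `w (k + 1) - w k`. By concavity of `w` this is largest at `k = j`. -/
theorem exists_lineDeriv_anisotropicWeight_le (hL : ∀ k ξ, L k (A ξ) = L (k + 1) ξ)
    (hw : ∀ k, 0 < w k) (hw1 : ∀ k, r ≤ k → w k = 1) (hmono : Monotone w)
    (hconc : Antitone fun k => w (k + 1) - w k) :
    ∃ C : ℝ, 0 ≤ C ∧ ∀ ξ, ∃ U' : ℝ,
      HasLineDerivAt ℝ (anisotropicWeight L w r j) U' ξ (A ξ) ∧
      |U'| ≤ C * anisotropicWeight L w r j ξ ^ (1 + w (j + 1) - w j) := by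
  obtain ⟨K, hK, hLK⟩ := exists_japaneseBracket_le_anisotropicWeight_rpow L (j := j) hw hw1
  have hp : ∀ k, 0 ≤ (w k)⁻¹ := fun k => (inv_pos.2 (hw k)).le
  refine ⟨‖A‖ + ∑ k ∈ Ico j r, (w k)⁻¹ * K, add_nonneg (norm_nonneg A)
    (sum_nonneg fun k _ => mul_nonneg (hp k) (by linarith)), fun ξ => ?_⟩
  have hU := anisotropicWeight_pos L w r j ξ
  have hU1 := one_le_anisotropicWeight L w r j ξ
  -- The term `⟨ξ⟩` is the case of the identity map with exponent `1`.
  have h0 := hasLineDerivAt_japaneseBracket_clm_rpow (ContinuousLinearMap.id ℝ _) ξ (A ξ) 1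
  simp only [ContinuousLinearMap.id_apply, Real.rpow_one] at h0
  have h1 := fun k => hasLineDerivAt_japaneseBracket_clm_rpow (L k) ξ (A ξ) (w k)⁻¹
  refine ⟨_, HasDerivAt.add h0 (HasDerivAt.fun_sum fun k _ => h1 k), ?_⟩
  refine (abs_add_le _ _).trans ?_
  rw [add_mul, sum_mul]
  refine add_le_add ?_ ((abs_sum_le_sum_abs _ _).trans (sum_le_sum fun k hk => ?_))
  · refine (abs_inner_mul_bracket_le ξ (A ξ) zero_le_one).trans ?_
    rw [sub_self, Real.rpow_zero, one_mul, one_mul]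
    refine (A.le_opNorm ξ).trans ?_
    gcongr
    refine ((norm_le_japaneseBracket ξ).trans
      (japaneseBracket_le_anisotropicWeight L w r j ξ)).trans ?_
    refine Real.self_le_rpow_of_one_le hU1 ?_
    linarith [hmono j.le_succ]
  · obtain ⟨hjk, hkr⟩ := mem_Ico.1 hk
    refine (abs_inner_mul_bracket_le (L k ξ) (L k (A ξ)) (hp k)).trans ?_
    have hp1 : 0 ≤ (w k)⁻¹ - 1 := by
      have := hmono hkr.le
      rw [hw1 r le_rfl] at this
      linarith [(one_le_inv₀ (hw k)).2 this]
    rw [hL, mul_assoc, mul_assoc]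
    refine mul_le_mul_of_nonneg_left ?_ (hp k)
    have e1 : japaneseBracket (L k ξ) ^ ((w k)⁻¹ - 1)
        ≤ anisotropicWeight L w r j ξ ^ (1 - w k) := by
      have := Real.rpow_le_rpow (japaneseBracket_pos _).le
        (japaneseBracket_le_anisotropicWeight_rpow L hw hjk hkr ξ) hp1
      rwa [← Real.rpow_mul hU.le, mul_sub, mul_inv_cancel₀ (hw k).ne', mul_one] at this
    have e2 := (norm_le_japaneseBracket _).trans (hLK (k + 1) (by omega) (by omega) ξ)
    calc _ ≤ anisotropicWeight L w r j ξ ^ (1 - w k)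
          * (K * anisotropicWeight L w r j ξ ^ w (k + 1)) := by gcongr
      _ = K * anisotropicWeight L w r j ξ ^ (1 - w k + w (k + 1)) := by
        rw [Real.rpow_add hU]; ring
      _ ≤ _ := by
        refine mul_le_mul_of_nonneg_left (Real.rpow_le_rpow_of_exponent_le hU1 ?_) (by linarith)
        have := hconc hjk
        simp only at this
        linarith

theorem exists_anisotropicWeight_rpow_le {ν : ℝ} (hν : 0 < ν) :
    ∃ K : ℝ, 0 < K ∧ ∀ ξ, anisotropicWeight L w r j ξ ^ ν
      ≤ K * (japaneseBracket ξ ^ ν + ∑ k ∈ range r, japaneseBracket (L k ξ) ^ (ν / w k)) := by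
  refine ⟨(1 + (Ico j r).card : ℝ) ^ ν, by positivity, fun ξ => ?_⟩
  have hJ := japaneseBracket_pos ξ
  have hk : ∀ k ∈ range r, 0 ≤ japaneseBracket (L k ξ) ^ (ν / w k) := fun k _ =>
    (Real.rpow_pos_of_pos (japaneseBracket_pos _) _).le
  set E := japaneseBracket ξ ^ ν + ∑ k ∈ range r, japaneseBracket (L k ξ) ^ (ν / w k) with hE
  have hE0 : 0 < E := add_pos_of_pos_of_nonneg (Real.rpow_pos_of_pos hJ _) (sum_nonneg hk)
  have hEν := Real.rpow_pos_of_pos hE0 ν⁻¹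
  -- Each summand `t` of the weight satisfies `t ^ ν ≤ E`.
  have hle : anisotropicWeight L w r j ξ ≤ (1 + (Ico j r).card) * E ^ ν⁻¹ := by
    rw [add_mul, one_mul, ← nsmul_eq_mul]
    refine add_le_add ?_ (sum_le_card_nsmul _ _ _ fun k hkj => ?_)
    · rw [Real.le_rpow_inv_iff_of_pos hJ.le hE0.le hν]
      linarith [sum_nonneg hk]
    · have hJk := japaneseBracket_pos (L k ξ)
      rw [Real.le_rpow_inv_iff_of_pos (by positivity) hE0.le hν, ← Real.rpow_mul hJk.le,
        inv_mul_eq_div]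
      have := single_le_sum hk (mem_range.2 (mem_Ico.1 hkj).2)
      linarith [Real.rpow_pos_of_pos hJ ν]
  have := Real.rpow_le_rpow (anisotropicWeight_pos L w r j ξ).le hle hν.le
  rwa [Real.mul_rpow (by positivity) hEν.le, Real.rpow_inv_rpow hE0.le hν.ne'] at this

end Weight

/-! ### The elementary multipliers -/

section Multiplier

variable {n : ℕ} (L : ℕ → EuclideanSpace ℝ (Fin n) →L[ℝ] EuclideanSpace ℝ (Fin n))
  (A : EuclideanSpace ℝ (Fin n) →L[ℝ] EuclideanSpace ℝ (Fin n)) (w : ℕ → ℝ) (r j : ℕ) (a b : ℝ)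

/-- The elementary multiplier `(L_j ξ · L_{j+1} ξ) ⟨L_{j+1} ξ⟩ᵃ U_j(ξ)^{-b}`. -/
noncomputable def multiplier (ξ : EuclideanSpace ℝ (Fin n)) : ℝ :=
  inner ℝ (L j ξ) (L (j + 1) ξ) * japaneseBracket (L (j + 1) ξ) ^ a
    * anisotropicWeight L w r j ξ ^ (-b)

theorem contDiff_multiplier : ContDiff ℝ ∞ (multiplier L w r j a b) :=
  (((L j).contDiff.inner ℝ (L (j + 1)).contDiff).mul
    ((contDiff_japaneseBracket.comp (L (j + 1)).contDiff).rpow_const_of_ne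
      fun ξ => (japaneseBracket_pos (L (j + 1) ξ)).ne')).mul
    ((contDiff_anisotropicWeight L w r j).rpow_const_of_ne
      fun ξ => (anisotropicWeight_pos L w r j ξ).ne')

variable {A w r j a b}

theorem hasLineDerivAt_multiplier (hL : ∀ k ξ, L k (A ξ) = L (k + 1) ξ)
    {ξ : EuclideanSpace ℝ (Fin n)} {U' : ℝ}
    (hU' : HasLineDerivAt ℝ (anisotropicWeight L w r j) U' ξ (A ξ)) :
    HasLineDerivAt ℝ (multiplier L w r j a b)
      (((inner ℝ (L j ξ) (L (j + 2) ξ) + inner ℝ (L (j + 1) ξ) (L (j + 1) ξ))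
            * japaneseBracket (L (j + 1) ξ) ^ a
          + inner ℝ (L j ξ) (L (j + 1) ξ)
            * (inner ℝ (L (j + 1) ξ) (L (j + 2) ξ) * a * japaneseBracket (L (j + 1) ξ) ^ (a - 2)))
          * anisotropicWeight L w r j ξ ^ (-b)
        + inner ℝ (L j ξ) (L (j + 1) ξ) * japaneseBracket (L (j + 1) ξ) ^ a
          * (U' * (-b) * anisotropicWeight L w r j ξ ^ (-b - 1))) ξ (A ξ) := by
  have hlin : ∀ k, HasDerivAt (fun t : ℝ => L k (ξ + t • A ξ)) (L (k + 1) ξ) 0 := by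
    intro k
    have : HasDerivAt (fun t : ℝ => L k ξ + t • L (k + 1) ξ) ((1 : ℝ) • L (k + 1) ξ) 0 :=
      ((hasDerivAt_id (0 : ℝ)).smul_const _).const_add _
    simpa [hL] using this
  have h1 := (hlin j).inner ℝ (hlin (j + 1))
  have h2 := hasLineDerivAt_japaneseBracket_clm_rpow (L (j + 1)) ξ (A ξ) a
  rw [hL] at h2
  have h3 := HasDerivAt.rpow_const (p := -b) hU'
    (Or.inl (anisotropicWeight_pos L w r j _).ne')
  refine ((h1.mul h2).mul h3).congr_deriv ?_
  simp only [zero_smul, add_zero, Pi.mul_apply]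

/-- The square of `L_{j+1} ξ` produced by the derivation of `L_j ξ · L_{j+1} ξ` dominates, up to
terms that are small where `L_j ξ` is small relative to the weight. -/
theorem exists_bracket_rpow_le_fderiv_multiplier (hL : ∀ k ξ, L k (A ξ) = L (k + 1) ξ)
    (hw : ∀ k, 0 < w k) (hw1 : ∀ k, r ≤ k → w k = 1) (hmono : Monotone w)
    (hconc : Antitone fun k => w (k + 1) - w k) (hj : j < r) {ν : ℝ}
    (ha : 0 ≤ a) (hb : 0 ≤ b) (hν : (2 + a) * w (j + 1) - b = ν) :
    ∃ C : ℝ, 0 ≤ C ∧ ∀ ξ,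
      japaneseBracket (L (j + 1) ξ) ^ (2 + a) * anisotropicWeight L w r j ξ ^ (-b)
        ≤ fderiv ℝ (multiplier L w r j a b) ξ (A ξ)
          + C * (japaneseBracket (L j ξ) * anisotropicWeight L w r j ξ ^ (ν - w j)) := by
  obtain ⟨K, hK, hLK⟩ := exists_japaneseBracket_le_anisotropicWeight_rpow L (j := j) hw hw1
  obtain ⟨C, hC, hUC⟩ :=
    exists_lineDeriv_anisotropicWeight_le L A (j := j) hL hw hw1 hmono hconc
  refine ⟨K ^ a + (1 + a) * K * K ^ a + b * K * K ^ a * C, by positivity, fun ξ => ?_⟩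
  obtain ⟨U', hU', hU'C⟩ := hUC ξ
  have hD := ((contDiff_multiplier L w r j a b).differentiable (by simp) ξ).hasFDerivAt
    |>.hasLineDerivAt (A ξ)
  rw [hD.unique (hasLineDerivAt_multiplier L hL hU')]
  have hU := anisotropicWeight_pos L w r j ξ
  have hU1 := one_le_anisotropicWeight L w r j ξ
  set U := anisotropicWeight L w r j ξ with hUdef
  have hy := japaneseBracket_pos (L (j + 1) ξ)
  have hyK := hLK (j + 1) (by omega) (by omega) ξ
  have hz1 := one_le_japaneseBracket (L j ξ)
  have hyn := norm_le_japaneseBracket (L (j + 1) ξ)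
  have hxz := norm_le_japaneseBracket (L j ξ)
  have hv := (norm_le_japaneseBracket _).trans (hLK (j + 2) (by omega) (by omega) ξ)
  have hysq := japaneseBracket_sq (L (j + 1) ξ)
  have hy2 := abs_inner_mul_bracket_le (L (j + 1) ξ) (L (j + 2) ξ) ha
  rw [real_inner_self_eq_norm_sq]
  have hc := hconc j.le_succ
  have hm := hmono j.le_succ
  simp only at hc
  set y := japaneseBracket (L (j + 1) ξ)
  set z := japaneseBracket (L j ξ)
  have hyp : ∀ p : ℝ, 0 < y ^ p := fun p => Real.rpow_pos_of_pos hy p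
  have hUp : ∀ p : ℝ, 0 < U ^ p := fun p => Real.rpow_pos_of_pos hU p
  have hKa : 0 ≤ K ^ a := by positivity
  have hya : y ^ a ≤ K ^ a * U ^ (a * w (j + 1)) := by
    have := Real.rpow_le_rpow hy.le hyK ha
    rwa [Real.mul_rpow (by linarith) (hUp _).le, ← Real.rpow_mul hU.le, mul_comm (w _)] at this
  -- Passing from `‖L_{j+1} ξ‖²` to `⟨L_{j+1} ξ⟩²` costs an error that `1 ≤ z` makes admissible.
  have e0 : y ^ a * U ^ (-b) ≤ K ^ a * (z * U ^ (ν - w j)) := by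
    calc y ^ a * U ^ (-b) ≤ K ^ a * U ^ (a * w (j + 1)) * U ^ (-b) :=
          mul_le_mul_of_nonneg_right hya (hUp _).le
      _ = K ^ a * (1 * U ^ (a * w (j + 1) + -b)) := by rw [Real.rpow_add hU]; ring
      _ ≤ K ^ a * (z * U ^ (ν - w j)) := by
        refine mul_le_mul_of_nonneg_left (mul_le_mul hz1
          (Real.rpow_le_rpow_of_exponent_le hU1 ?_) (hUp _).le (by linarith)) hKa
        linarith [hw (j + 1)]
  -- Concavity, as `w (j + 2) + w j ≤ 2 * w (j + 1)`, controls every term containing `L_{j+2} ξ`.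
  have ev : ‖L (j + 2) ξ‖ * y ^ a * U ^ (-b) ≤ K * K ^ a * U ^ (ν - w j) := by
    calc _ ≤ (K * U ^ w (j + 2)) * (K ^ a * U ^ (a * w (j + 1))) * U ^ (-b) := by
          gcongr
      _ = K * K ^ a * U ^ (w (j + 2) + a * w (j + 1) + -b) := by
        rw [Real.rpow_add hU, Real.rpow_add hU]; ring
      _ ≤ _ := by
        refine mul_le_mul_of_nonneg_left (Real.rpow_le_rpow_of_exponent_le hU1 ?_)
          (by positivity)
        have : j + 1 + 1 = j + 2 := rfl
        simp only [Nat.succ_eq_add_one, this] at hc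
        linarith
  -- The derivative falls on `L_{j+1} ξ` in the scalar product.
  have e1 : |inner ℝ (L j ξ) (L (j + 2) ξ) * y ^ a * U ^ (-b)|
      ≤ K * K ^ a * (z * U ^ (ν - w j)) := by
    rw [abs_mul, abs_mul, abs_of_pos (hyp a), abs_of_pos (hUp _)]
    calc _ ≤ (z * ‖L (j + 2) ξ‖) * y ^ a * U ^ (-b) := by
          have := hyp a
          have := hUp (-b)
          gcongr
          exact (abs_real_inner_le_norm _ _).trans (by gcongr)
      _ = z * (‖L (j + 2) ξ‖ * y ^ a * U ^ (-b)) := by ring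
      _ ≤ z * (K * K ^ a * U ^ (ν - w j)) := mul_le_mul_of_nonneg_left ev (by linarith)
      _ = _ := by ring
  -- The derivative falls on `⟨L_{j+1} ξ⟩ᵃ`.
  have e2 : |inner ℝ (L j ξ) (L (j + 1) ξ)
        * (inner ℝ (L (j + 1) ξ) (L (j + 2) ξ) * a * y ^ (a - 2)) * U ^ (-b)|
      ≤ a * K * K ^ a * (z * U ^ (ν - w j)) := by
    rw [abs_mul, abs_mul (inner ℝ (L j ξ) (L (j + 1) ξ)), abs_of_pos (hUp _)]
    calc _ ≤ (z * y) * (a * y ^ (a - 1) * ‖L (j + 2) ξ‖) * U ^ (-b) := by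
          have := hUp (-b)
          gcongr
          exact (abs_real_inner_le_norm _ _).trans (by gcongr)
      _ = a * z * (‖L (j + 2) ξ‖ * (y ^ (a - 1) * y) * U ^ (-b)) := by ring
      _ = a * z * (‖L (j + 2) ξ‖ * y ^ a * U ^ (-b)) := by
        rw [← Real.rpow_add_one hy.ne', sub_add_cancel]
      _ ≤ a * z * (K * K ^ a * U ^ (ν - w j)) :=
        mul_le_mul_of_nonneg_left ev (mul_nonneg ha (by linarith))
      _ = _ := by ring
  -- The derivative falls on the weight.
  have e3 : |inner ℝ (L j ξ) (L (j + 1) ξ) * y ^ a * (U' * (-b) * U ^ (-b - 1))|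
      ≤ b * K * K ^ a * C * (z * U ^ (ν - w j)) := by
    rw [abs_mul, abs_mul, abs_mul, abs_mul, abs_neg, abs_of_nonneg hb, abs_of_pos (hyp a),
      abs_of_pos (hUp _)]
    calc _ ≤ (z * (K * U ^ w (j + 1))) * (K ^ a * U ^ (a * w (j + 1)))
          * ((C * U ^ (1 + w (j + 1) - w j)) * b * U ^ (-b - 1)) := by
          have := hUp (-b - 1)
          have := hUp (w (j + 1))
          have := hyp a
          have h := (abs_real_inner_le_norm (L j ξ) (L (j + 1) ξ)).trans
            (mul_le_mul hxz (hyn.trans hyK) (norm_nonneg _) (by linarith))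
          gcongr
      _ = b * K * K ^ a * C * (z * (U ^ w (j + 1) * U ^ (a * w (j + 1))
          * U ^ (1 + w (j + 1) - w j) * U ^ (-b - 1))) := by ring
      _ = _ := by
        rw [← Real.rpow_add hU, ← Real.rpow_add hU, ← Real.rpow_add hU, ← hν]
        ring_nf
  have hmain : y ^ (2 + a) * U ^ (-b)
      = ‖L (j + 1) ξ‖ ^ 2 * y ^ a * U ^ (-b) + y ^ a * U ^ (-b) := by
    rw [Real.rpow_add hy, Real.rpow_two, hysq]; ring
  rw [hmain]
  have e1' := neg_abs_le (inner ℝ (L j ξ) (L (j + 2) ξ) * y ^ a * U ^ (-b))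
  have e2' := neg_abs_le (inner ℝ (L j ξ) (L (j + 1) ξ)
        * (inner ℝ (L (j + 1) ξ) (L (j + 2) ξ) * a * y ^ (a - 2)) * U ^ (-b))
  have e3' := neg_abs_le
    (inner ℝ (L j ξ) (L (j + 1) ξ) * y ^ a * (U' * (-b) * U ^ (-b - 1)))
  linarith

/-- One splits `⟨L_j ξ⟩ = ⟨L_j ξ⟩^q ⟨L_j ξ⟩^{1-q}` and
`⟨L_{j+1} ξ⟩^{1+a} = ⟨L_{j+1} ξ⟩^s ⟨L_{j+1} ξ⟩^{1+a-s}`. The second factors are bounded by powers of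
the weight, which `U_j^{-b}` cancels exactly. -/
theorem exists_abs_multiplier_le (hw : ∀ k, 0 < w k) (hw1 : ∀ k, r ≤ k → w k = 1) (hj : j < r)
    {q s : ℝ} (hq1 : q ≤ 1) (hs : 0 ≤ s) (ha : s ≤ 1 + a)
    (hb : b = (1 + a - s) * w (j + 1) + (1 - q) * w j) :
    ∃ c : ℝ, 0 < c ∧ ∀ ξ, |multiplier L w r j a b ξ|
      ≤ c * (japaneseBracket (L j ξ) ^ q * japaneseBracket ξ ^ s) := by
  obtain ⟨K, hK, hLK⟩ := exists_japaneseBracket_le_anisotropicWeight_rpow L (j := j) hw hw1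
  refine ⟨K ^ (1 + a - s) * (1 + ‖L (j + 1)‖) ^ s, by positivity, fun ξ => ?_⟩
  have hU := anisotropicWeight_pos L w r j ξ
  unfold multiplier
  have hS := japaneseBracket_pos ξ
  have hy := japaneseBracket_pos (L (j + 1) ξ)
  have hz := japaneseBracket_pos (L j ξ)
  have hyK := hLK (j + 1) (by omega) (by omega) ξ
  have hzU := japaneseBracket_le_anisotropicWeight_rpow L hw le_rfl hj ξ
  have hyS := japaneseBracket_clm_le (L (j + 1)) ξ
  have hyn := norm_le_japaneseBracket (L (j + 1) ξ)
  have hxz := norm_le_japaneseBracket (L j ξ)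
  have hin := (abs_real_inner_le_norm (L j ξ) (L (j + 1) ξ)).trans
    (mul_le_mul hxz hyn (norm_nonneg _) hz.le)
  set U := anisotropicWeight L w r j ξ
  set y := japaneseBracket (L (j + 1) ξ)
  set z := japaneseBracket (L j ξ)
  set S := japaneseBracket ξ
  have hUp : ∀ p : ℝ, 0 < U ^ p := fun p => Real.rpow_pos_of_pos hU p
  have hyp : ∀ p : ℝ, 0 < y ^ p := fun p => Real.rpow_pos_of_pos hy p
  have hzp : ∀ p : ℝ, 0 < z ^ p := fun p => Real.rpow_pos_of_pos hz p
  have h1 : z ^ (1 - q) ≤ U ^ ((1 - q) * w j) := by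
    rw [mul_comm, Real.rpow_mul hU.le]
    exact Real.rpow_le_rpow hz.le hzU (by linarith)
  have h2 : y ^ (1 + a - s) ≤ K ^ (1 + a - s) * U ^ ((1 + a - s) * w (j + 1)) := by
    rw [mul_comm _ (w (j + 1)), Real.rpow_mul hU.le, ← Real.mul_rpow (by linarith) (hUp _).le]
    exact Real.rpow_le_rpow hy.le hyK (by linarith)
  have h3 : y ^ s ≤ (1 + ‖L (j + 1)‖) ^ s * S ^ s := by
    rw [← Real.mul_rpow (by positivity) hS.le]
    exact Real.rpow_le_rpow hy.le hyS hs
  rw [abs_mul, abs_mul, abs_of_pos (hyp a), abs_of_pos (hUp _)]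
  calc _ ≤ (z * y) * y ^ a * U ^ (-b) := by
        have := hyp a
        have := hUp (-b)
        gcongr
    _ = (z ^ q * z ^ (1 - q)) * (y ^ (1 + a - s) * y ^ s) * U ^ (-b) := by
      rw [← Real.rpow_add hz, ← Real.rpow_add hy, add_sub_cancel, sub_add_cancel, Real.rpow_one,
        Real.rpow_add hy, Real.rpow_one]
      ring
    _ ≤ (z ^ q * U ^ ((1 - q) * w j)) * ((K ^ (1 + a - s) * U ^ ((1 + a - s) * w (j + 1)))
        * ((1 + ‖L (j + 1)‖) ^ s * S ^ s)) * U ^ (-b) := by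
      have := hUp (-b)
      have := hzp q
      have := hzp (1 - q)
      have := hyp (1 + a - s)
      have := hyp s
      have := hUp ((1 - q) * w j)
      have := hUp ((1 + a - s) * w (j + 1))
      gcongr
    _ = K ^ (1 + a - s) * (1 + ‖L (j + 1)‖) ^ s * (z ^ q * S ^ s)
        * (U ^ ((1 - q) * w j) * U ^ ((1 + a - s) * w (j + 1)) * U ^ (-b)) := by ring
    _ = _ := by
      rw [← Real.rpow_add hU, ← Real.rpow_add hU, hb, show (1 - q) * w j
        + (1 + a - s) * w (j + 1) + -((1 + a - s) * w (j + 1) + (1 - q) * w j) = 0 by ring,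
        Real.rpow_zero, mul_one]

end Multiplier

/-! ### Absorption and descent along the chain -/

/-- If `z` is not small compared with `U ^ w`, then `U ^ ν` is itself bounded by a multiple of
`z ^ (ν / w)`. -/
theorem exists_mul_rpow_sub_le {w ν ε : ℝ} (hw : 0 < w) (hν : 0 < ν) (hε : 0 < ε) :
    ∃ N : ℝ, 0 ≤ N ∧ ∀ U z : ℝ, 0 < U → 0 < z → z ≤ U ^ w →
      z * U ^ (ν - w) ≤ ε * U ^ ν + N * z ^ (ν / w) := by
  refine ⟨(ε⁻¹) ^ (ν / w), by positivity, fun U z hU hz hzU => ?_⟩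
  have hUν := Real.rpow_pos_of_pos hU ν
  have hUνw := Real.rpow_pos_of_pos hU (ν - w)
  have hsplit : U ^ w * U ^ (ν - w) = U ^ ν := by
    rw [← Real.rpow_add hU, add_sub_cancel]
  rw [← Real.mul_rpow (by positivity) hz.le]
  rcases le_total z (ε * U ^ w) with h | h
  · have h1 : z * U ^ (ν - w) ≤ ε * U ^ w * U ^ (ν - w) := by gcongr
    have h2 : 0 ≤ (ε⁻¹ * z) ^ (ν / w) := by positivity
    rw [mul_assoc, hsplit] at h1
    linarith
  · have h1 : z * U ^ (ν - w) ≤ U ^ w * U ^ (ν - w) := by gcongr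
    have h2 : U ^ w ≤ ε⁻¹ * z := by
      rw [inv_mul_eq_div, le_div_iff₀ hε]; linarith
    have h3 := Real.rpow_le_rpow (Real.rpow_pos_of_pos hU w).le h2 (div_pos hν hw).le
    rw [← Real.rpow_mul hU.le, mul_div_cancel₀ _ hw.ne'] at h3
    rw [hsplit] at h1
    linarith [mul_pos hε hUν]

/-- Either `y` is small compared with `U ^ w`, and `y ^ (ν / w)` is a small multiple of `U ^ ν`, or
`y` is comparable to `U ^ w`, and then `y ^ (2 + a) * U ^ (-b)` is of size `U ^ ν`. -/
theorem exists_rpow_le_add_mul_rpow {w ν a b K δ : ℝ} (hw : 0 < w) (hν : 0 < ν) (ha : 0 ≤ a)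
    (hb : (2 + a) * w - b = ν) (hK : 0 < K) (hδ : 0 < δ) :
    ∃ M : ℝ, 0 ≤ M ∧ ∀ U y : ℝ, 0 < U → 0 < y → y ≤ K * U ^ w →
      y ^ (ν / w) ≤ δ * U ^ ν + M * (y ^ (2 + a) * U ^ (-b)) := by
  -- The threshold for `y / U ^ w` at which `y ^ (ν / w)` equals `δ * U ^ ν`.
  set η := δ ^ (w / ν) with hη
  have hη0 : 0 < η := Real.rpow_pos_of_pos hδ _
  refine ⟨K ^ (ν / w) / η ^ (2 + a), by positivity, fun U y hU hy hyU => ?_⟩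
  have hUν := Real.rpow_pos_of_pos hU ν
  have hUw := Real.rpow_pos_of_pos hU w
  have hνw := (div_pos hν hw).le
  have hpow : (U ^ w) ^ (ν / w) = U ^ ν := by
    rw [← Real.rpow_mul hU.le, mul_div_cancel₀ _ hw.ne']
  rcases le_total y (η * U ^ w) with h | h
  · have h1 := Real.rpow_le_rpow hy.le h hνw
    rw [Real.mul_rpow hη0.le hUw.le, hpow, hη, ← Real.rpow_mul hδ.le,
      div_mul_div_cancel₀ hν.ne', div_self hw.ne', Real.rpow_one] at h1
    have : 0 ≤ K ^ (ν / w) / η ^ (2 + a) * (y ^ (2 + a) * U ^ (-b)) := by positivity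
    linarith
  · have h1 := Real.rpow_le_rpow hy.le hyU hνw
    rw [Real.mul_rpow hK.le hUw.le, hpow] at h1
    have h2 : η ^ (2 + a) * U ^ ν ≤ y ^ (2 + a) * U ^ (-b) := by
      have h3 := Real.rpow_le_rpow (by positivity) h (by linarith : 0 ≤ 2 + a)
      rw [Real.mul_rpow hη0.le hUw.le, ← Real.rpow_mul hU.le] at h3
      calc η ^ (2 + a) * U ^ ν = η ^ (2 + a) * U ^ (w * (2 + a)) * U ^ (-b) := by
            rw [mul_assoc, ← Real.rpow_add hU, ← hb]; ring_nf
        _ ≤ _ := by gcongr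
    calc y ^ (ν / w) ≤ K ^ (ν / w) / η ^ (2 + a) * (η ^ (2 + a) * U ^ ν) := by
          rw [← mul_assoc, div_mul_cancel₀ _ (Real.rpow_pos_of_pos hη0 _).ne']; exact h1
      _ ≤ K ^ (ν / w) / η ^ (2 + a) * (y ^ (2 + a) * U ^ (-b)) := by gcongr
      _ ≤ _ := by linarith [mul_pos hδ hUν]

section Descent

variable {n : ℕ} {L : ℕ → EuclideanSpace ℝ (Fin n) →L[ℝ] EuclideanSpace ℝ (Fin n)}
  {A : EuclideanSpace ℝ (Fin n) →L[ℝ] EuclideanSpace ℝ (Fin n)} {w : ℕ → ℝ} {r : ℕ}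

/-- The descent step: modulo the derivative of a multiplier and a small multiple of `U_j ^ ν`, the
bracket of index `j + 1` is controlled by that of index `j`. -/
theorem exists_bracket_rpow_succ_le (hL : ∀ k ξ, L k (A ξ) = L (k + 1) ξ)
    (hw : ∀ k, 0 < w k) (hw1 : ∀ k, r ≤ k → w k = 1) (hmono : Monotone w)
    (hconc : Antitone fun k => w (k + 1) - w k) {j : ℕ} (hj : j < r) {a b ν δ : ℝ}
    (hν : 0 < ν) (ha : 0 ≤ a) (hb : 0 ≤ b) (hab : (2 + a) * w (j + 1) - b = ν) (hδ : 0 < δ) :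
    ∃ M N : ℝ, 0 ≤ M ∧ 0 ≤ N ∧ ∀ ξ,
      japaneseBracket (L (j + 1) ξ) ^ (ν / w (j + 1))
        ≤ M * fderiv ℝ (multiplier L w r j a b) ξ (A ξ)
          + N * japaneseBracket (L j ξ) ^ (ν / w j) + δ * anisotropicWeight L w r j ξ ^ ν := by
  obtain ⟨K, hK, hLK⟩ := exists_japaneseBracket_le_anisotropicWeight_rpow L (j := j) hw hw1
  obtain ⟨C, hC, hX⟩ := exists_bracket_rpow_le_fderiv_multiplier L hL hw hw1 hmono hconc hj
    ha hb hab
  obtain ⟨M, hM, hy⟩ := exists_rpow_le_add_mul_rpow (hw (j + 1)) hν ha hab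
    (one_pos.trans_le hK) (half_pos hδ)
  -- This smallness makes the error, after multiplication by `M * C`, at most `δ / 2 * U ^ ν`.
  obtain ⟨N, hN, hz⟩ := exists_mul_rpow_sub_le (hw j) hν
    (show 0 < δ / 2 / (M * C + 1) by positivity)
  refine ⟨M, M * C * N, hM, by positivity, fun ξ => ?_⟩
  have hU := anisotropicWeight_pos L w r j ξ
  have hUν := Real.rpow_pos_of_pos hU ν
  have h1 := hy _ _ hU (japaneseBracket_pos _) (hLK (j + 1) (by omega) (by omega) ξ)
  have h2 := mul_le_mul_of_nonneg_left (hz _ _ hU (japaneseBracket_pos _)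
    (japaneseBracket_le_anisotropicWeight_rpow L hw le_rfl hj ξ)) (mul_nonneg hM hC)
  have h3 := mul_le_mul_of_nonneg_left (hX ξ) hM
  have h4 : M * C * (δ / 2 / (M * C + 1) * anisotropicWeight L w r j ξ ^ ν)
      ≤ δ / 2 * anisotropicWeight L w r j ξ ^ ν := by
    rw [← mul_assoc]
    refine mul_le_mul_of_nonneg_right ?_ hUν.le
    rw [mul_div_assoc', div_le_iff₀ (by positivity)]
    nlinarith
  linarith

/-- The Kalman-type lower bound makes the largest `⟨L_k ξ⟩` comparable to `⟨ξ⟩`. Raising the exponent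
from `ν` to `p k` is then harmless because brackets are at least `1`. -/
theorem exists_bracket_rpow_le_sum {Ω : Set (EuclideanSpace ℝ (Fin n))} {c₀ : ℝ} (hc₀ : 0 < c₀)
    (hkalman : ∀ ξ ∈ Ω, c₀ * ‖ξ‖ ^ 2 ≤ ∑ k ∈ range (r + 1), ‖L k ξ‖ ^ 2)
    {p : ℕ → ℝ} {ν : ℝ} (hν : 0 < ν) (hp : ∀ k ≤ r, ν ≤ p k) :
    ∃ C : ℝ, 0 < C ∧ ∀ ξ ∈ Ω, japaneseBracket ξ ^ ν
      ≤ C * ∑ k ∈ range (r + 1), japaneseBracket (L k ξ) ^ p k := by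
  set c := 1 + c₀⁻¹ with hc
  have hc0 : 0 < c := by positivity
  refine ⟨(√(c * (r + 1))) ^ ν, by positivity, fun ξ hξ => ?_⟩
  obtain ⟨k, hk, hmax⟩ := exists_max_image (range (r + 1))
    (fun k => japaneseBracket (L k ξ)) ⟨0, by simp⟩
  have hJk := japaneseBracket_pos (L k ξ)
  have hS : japaneseBracket ξ ≤ √(c * (r + 1)) * japaneseBracket (L k ξ) := by
    rw [← Real.sqrt_sq hJk.le, ← Real.sqrt_mul (by positivity)]
    refine Real.le_sqrt_of_sq_le ?_
    have h1 : ∑ i ∈ range (r + 1), ‖L i ξ‖ ^ 2 ≤ (r + 1) * (japaneseBracket (L k ξ) ^ 2) := by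
      refine (sum_le_card_nsmul _ _ (japaneseBracket (L k ξ) ^ 2) fun i hi => ?_).trans_eq
        (by simp)
      have := (norm_le_japaneseBracket (L i ξ)).trans (hmax i hi)
      gcongr
    have h2 : ‖ξ‖ ^ 2 ≤ c₀⁻¹ * ((r + 1) * (japaneseBracket (L k ξ) ^ 2)) := by
      rw [le_inv_mul_iff₀ hc₀]
      exact (hkalman ξ hξ).trans h1
    have h3 : 1 ≤ (r + 1 : ℝ) * (japaneseBracket (L k ξ) ^ 2) := by
      have : (1 : ℝ) ≤ r + 1 := by linarith [(Nat.cast_nonneg r : (0 : ℝ) ≤ r)]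
      nlinarith [one_le_japaneseBracket (L k ξ)]
    rw [japaneseBracket_sq, hc]
    linarith
  have h1 := Real.rpow_le_rpow (japaneseBracket_pos ξ).le hS hν.le
  rw [Real.mul_rpow (Real.sqrt_nonneg _) hJk.le] at h1
  refine h1.trans (mul_le_mul_of_nonneg_left ?_ (by positivity))
  refine (Real.rpow_le_rpow_of_exponent_le (one_le_japaneseBracket _)
    (hp k (by simpa [Nat.lt_succ_iff] using hk))).trans ?_
  exact single_le_sum (f := fun k => japaneseBracket (L k ξ) ^ p k)
    (fun k _ => (Real.rpow_pos_of_pos (japaneseBracket_pos (L k ξ)) _).le) hk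

/-- The terms of index `r, …, m + 1` on the right-hand side of the bound of
`exists_bracket_rpow_le_sum` are traded, one after the other, for the derivative of a multiplier.
Here `ν / w k` plays the role of `λ_k`. -/
theorem exists_global_multiplier (hL : ∀ k ξ, L k (A ξ) = L (k + 1) ξ)
    (hw : ∀ k, 0 < w k) (hw1 : ∀ k, r ≤ k → w k = 1) (hmono : Monotone w)
    (hconc : Antitone fun k => w (k + 1) - w k)
    {Ω : Set (EuclideanSpace ℝ (Fin n))} {c₀ : ℝ} (hc₀ : 0 < c₀)
    (hkalman : ∀ ξ ∈ Ω, c₀ * ‖ξ‖ ^ 2 ≤ ∑ k ∈ range (r + 1), ‖L k ξ‖ ^ 2)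
    {q s : ℕ → ℝ} (hq : ∀ j < r, q j ≤ 1) (hs : ∀ j < r, 0 ≤ s j) {ν : ℝ} (hν : 0 < ν)
    (hrec : ∀ j < r, ν = (1 + s j) * w (j + 1) - (1 - q j) * w j) {m : ℕ} (hm : m ≤ r) :
    ∃ c C : ℝ, 0 < c ∧ 0 < C ∧ ∃ G : EuclideanSpace ℝ (Fin n) → ℝ, ContDiff ℝ ∞ G ∧
      (∀ ξ, |G ξ| ≤ c * ∑ j ∈ range r,
        japaneseBracket (L j ξ) ^ q j * japaneseBracket ξ ^ s j) ∧
      ∀ ξ ∈ Ω, japaneseBracket ξ ^ ν + ∑ k ∈ range r, japaneseBracket (L k ξ) ^ (ν / w k)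
        ≤ C * ∑ k ∈ range (m + 1), japaneseBracket (L k ξ) ^ (ν / w k)
          + fderiv ℝ G ξ (A ξ) := by
  have hΛ : ∀ ξ k, 0 ≤ japaneseBracket (L k ξ) ^ (ν / w k) := fun ξ k =>
    (Real.rpow_pos_of_pos (japaneseBracket_pos _) _).le
  have hterm : ∀ ξ j, 0 ≤ japaneseBracket (L j ξ) ^ q j * japaneseBracket ξ ^ s j := fun ξ j =>
    mul_nonneg (Real.rpow_pos_of_pos (japaneseBracket_pos _) _).le
      (Real.rpow_pos_of_pos (japaneseBracket_pos _) _).le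
  refine Nat.decreasingInduction' (fun m hmr _ ih => ?_) hm ?_
  · obtain ⟨c, C, hc, hC, G, hG, hGc, hGE⟩ := ih
    -- A negative power of the bracket is not dominated by the same power of the weight, so
    -- `s m - 1` is truncated at `0` and the difference is charged to the weight.
    set a := max (s m - 1) 0 with ha
    have ha0 : 0 ≤ a := le_max_right _ _
    have has : s m ≤ 1 + a := by linarith [le_max_left (s m - 1) 0]
    set b := (1 + a - s m) * w (m + 1) + (1 - q m) * w m with hb
    have hb0 : 0 ≤ b := add_nonneg (mul_nonneg (by linarith) (hw _).le)
      (mul_nonneg (by linarith [hq m hmr]) (hw _).le)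
    have hab : (2 + a) * w (m + 1) - b = ν := by rw [hrec m hmr, hb]; ring
    obtain ⟨K, hK, hUE⟩ := exists_anisotropicWeight_rpow_le L (w := w) (r := r) (j := m) hν
    -- With this `δ` the error is at most half of the left-hand side, where it is absorbed.
    obtain ⟨M, N, hM, hN, hstep⟩ := exists_bracket_rpow_succ_le hL hw hw1 hmono hconc hmr hν
      ha0 hb0 hab (show 0 < 1 / (2 * C * K) by positivity)
    obtain ⟨c', hc', hg⟩ := exists_abs_multiplier_le L hw hw1 hmr (hq m hmr) (hs m hmr) has hb
    have hgs := contDiff_multiplier L w r m a b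
    refine ⟨2 * c + 2 * C * M * c', 2 * C + 2 * C * N, by positivity, by positivity,
      fun ξ => 2 * G ξ + 2 * C * M * multiplier L w r m a b ξ,
      (contDiff_const.mul hG).add (contDiff_const.mul hgs), fun ξ => ?_, fun ξ hξ => ?_⟩
    · refine (abs_add_le _ _).trans ?_
      rw [abs_mul, abs_mul, abs_of_pos two_pos, abs_of_nonneg (by positivity : 0 ≤ 2 * C * M),
        add_mul, mul_assoc 2 c, mul_assoc (2 * C * M) c']
      refine add_le_add (mul_le_mul_of_nonneg_left (hGc ξ) two_pos.le)
        (mul_le_mul_of_nonneg_left ((hg ξ).trans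
          (mul_le_mul_of_nonneg_left ?_ hc'.le)) (by positivity))
      exact single_le_sum (f := fun j => japaneseBracket (L j ξ) ^ q j * japaneseBracket ξ ^ s j)
        (fun j _ => hterm ξ j) (mem_range.2 hmr)
    · have hd : fderiv ℝ (fun ξ => 2 * G ξ + 2 * C * M * multiplier L w r m a b ξ) ξ (A ξ)
          = 2 * fderiv ℝ G ξ (A ξ)
            + 2 * C * M * fderiv ℝ (multiplier L w r m a b) ξ (A ξ) := by
        have h1 := (hG.differentiable (by simp) ξ).hasFDerivAt.const_mul 2
        have h2 := (hgs.differentiable (by simp) ξ).hasFDerivAt.const_mul (2 * C * M)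
        rw [(h1.fun_add h2).fderiv]
        simp
      rw [hd]
      have h1 := hGE ξ hξ
      rw [sum_range_succ _ (m + 1)] at h1
      have h2 := mul_le_mul_of_nonneg_left (hstep ξ) hC.le
      have h3 := hUE ξ
      have h4 : japaneseBracket (L m ξ) ^ (ν / w m)
          ≤ ∑ k ∈ range (m + 1), japaneseBracket (L k ξ) ^ (ν / w k) :=
        single_le_sum (f := fun k => japaneseBracket (L k ξ) ^ (ν / w k))
          (fun k _ => hΛ ξ k) (self_mem_range_succ m)
      have h5 := mul_le_mul_of_nonneg_left h4 (by positivity : 0 ≤ C * N)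
      set E := japaneseBracket ξ ^ ν + ∑ k ∈ range r, japaneseBracket (L k ξ) ^ (ν / w k)
      have h6 : C * (1 / (2 * C * K) * anisotropicWeight L w r m ξ ^ ν) ≤ E / 2 := by
        calc _ ≤ C * (1 / (2 * C * K) * (K * E)) := by gcongr
          _ = E / 2 := by field_simp
      linarith
  · obtain ⟨C, hC, hE⟩ := exists_bracket_rpow_le_sum hc₀ hkalman (p := fun k => ν / w k) hν
      (fun k hk => by
        rw [le_div_iff₀ (hw k)]
        have := hmono hk
        rw [hw1 r le_rfl] at this
        nlinarith)
    refine ⟨1, C + 1, one_pos, by positivity, fun _ => 0, contDiff_const, fun ξ => ?_,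
      fun ξ hξ => ?_⟩
    · rw [abs_zero, one_mul]
      exact sum_nonneg fun j _ => hterm ξ j
    · have h1 := hE ξ hξ
      have h2 : ∑ k ∈ range r, japaneseBracket (L k ξ) ^ (ν / w k)
          ≤ ∑ k ∈ range (r + 1), japaneseBracket (L k ξ) ^ (ν / w k) := by
        rw [sum_range_succ]; linarith [hΛ ξ r]
      simp only [fderiv_fun_const, Pi.zero_apply, zero_apply, add_zero]
      linarith

end Descent

/-! ### Normalized exponents and the final estimate -/

/-- The exponents `λ_r / λ_k` for `k ≤ r`, extended by the value `1` to `k ≥ r`, so that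
monotonicity and concavity hold on all of `ℕ`. -/
noncomputable def normalizedWeight (lam : ℕ → ℝ) (r k : ℕ) : ℝ := lam r / lam (min k r)

section NormalizedWeight

variable {lam : ℕ → ℝ} {r : ℕ}

theorem normalizedWeight_of_le {k : ℕ} (hk : k ≤ r) :
    normalizedWeight lam r k = lam r / lam k := by
  rw [normalizedWeight, min_eq_left hk]

theorem normalizedWeight_of_ge (hpos : ∀ k ≤ r, 0 < lam k) {k : ℕ} (hk : r ≤ k) :
    normalizedWeight lam r k = 1 := by
  rw [normalizedWeight, min_eq_right hk, div_self (hpos r le_rfl).ne']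

theorem monotone_normalizedWeight (hpos : ∀ k ≤ r, 0 < lam k)
    (hdecr : ∀ j < r, lam (j + 1) < lam j) : Monotone (normalizedWeight lam r) := by
  refine monotone_nat_of_le_succ fun k => ?_
  rcases lt_or_ge k r with hk | hk
  · rw [normalizedWeight_of_le hk.le, normalizedWeight_of_le hk]
    exact div_le_div_of_nonneg_left (hpos r le_rfl).le (hpos _ hk) (hdecr k hk).le
  · rw [normalizedWeight_of_ge hpos hk, normalizedWeight_of_ge hpos (hk.trans k.le_succ)]

theorem antitone_normalizedWeight_sub (hpos : ∀ k ≤ r, 0 < lam k)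
    (hdecr : ∀ j < r, lam (j + 1) < lam j)
    (hratio : ∀ j, 2 ≤ j → j ≤ r → lam (j - 1) / lam (j - 2) + lam (j - 1) / lam j ≤ 2) :
    Antitone fun k => normalizedWeight lam r (k + 1) - normalizedWeight lam r k := by
  refine antitone_nat_of_succ_le fun k => ?_
  rcases lt_or_ge (k + 1) r with hk | hk
  · have h := hratio (k + 2) (by omega) hk
    rw [show k + 2 - 1 = k + 1 by omega, show k + 2 - 2 = k by omega] at h
    rw [normalizedWeight_of_le (by omega : k ≤ r), normalizedWeight_of_le hk.le,
      normalizedWeight_of_le (by omega : k + 1 + 1 ≤ r)]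
    have h0 := hpos k (by omega)
    have h1 := hpos (k + 1) hk.le
    have h2 := hpos (k + 2) hk
    have hr := hpos r le_rfl
    have := mul_le_mul_of_nonneg_left h (div_pos hr h1).le
    rw [mul_add, div_mul_div_cancel₀ h1.ne', div_mul_div_cancel₀ h1.ne'] at this
    linarith
  · rw [normalizedWeight_of_ge hpos hk, normalizedWeight_of_ge hpos (hk.trans (k + 1).le_succ)]
    have := monotone_normalizedWeight hpos hdecr k.le_succ
    rw [Nat.succ_eq_add_one, normalizedWeight_of_ge hpos hk] at this
    linarith

end NormalizedWeight

theorem toEuclideanCLM_eq_matVec {n : ℕ} (M : Matrix (Fin n) (Fin n) ℝ)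
    (ξ : EuclideanSpace ℝ (Fin n)) :
    Matrix.toEuclideanCLM (n := Fin n) (𝕜 := ℝ) M ξ = matVec M ξ := rfl

theorem mainTheorem2 {n : ℕ} (B Q : Matrix (Fin n) (Fin n) ℝ) (hQ : Q.PosSemidef)
    (r : ℕ) (hr : 1 ≤ r)
    (Ω₀ : Set (EuclideanSpace ℝ (Fin n))) (hΩ₀ : IsOpen Ω₀)
    (hkalman : ∃ c₀ : ℝ, 0 < c₀ ∧ ∀ ξ ∈ Ω₀,
      c₀ * ‖ξ‖ ^ 2 ≤ ∑ j ∈ Finset.range (r + 1), ‖matVec (Q * B.transpose ^ j) ξ‖ ^ 2)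
    (q s : ℕ → ℝ)
    (hq : ∀ j < r, 0 ≤ q j ∧ q j ≤ 1) (hs : ∀ j < r, 0 ≤ s j)
    (hq_mono : 2 ≤ r → q (r - 2) ≤ q (r - 1))
    (hs_mono : 2 ≤ r → s (r - 2) ≤ s (r - 1))
    (hqs_zero : ∀ j, j + 3 ≤ r → q j = 0 ∧ s j = 0)
    (lam : ℕ → ℝ) (hlam_zero : 0 < lam 0)
    (hlam_rec : ∀ j < r, lam (j + 1) * ((1 - q j) / lam j + 1) = 1 + s j)
    (hlam_decr : ∀ j < r, lam (j + 1) < lam j)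
    (hlam_ratio : ∀ j, 2 ≤ j → j ≤ r →
      lam (j - 1) / lam (j - 2) + lam (j - 1) / lam j ≤ 2) :
    ∃ c₁ c₂ c₃ : ℝ, 0 < c₁ ∧ 0 < c₂ ∧ 0 < c₃ ∧
      ∃ g : EuclideanSpace ℝ (Fin n) → ℝ, ContDiff ℝ ∞ g ∧
        (∀ ξ ∈ Ω₀, |g ξ| ≤ c₁ * ∑ j ∈ Finset.range r,
          japaneseBracket (matVec (Q * B.transpose ^ j) ξ) ^ q j * japaneseBracket ξ ^ s j) ∧
        (∀ ξ ∈ Ω₀, japaneseBracket ξ ^ lam r ≤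
          c₂ * japaneseBracket (matVec Q ξ) ^ lam 0
            + c₃ * inner ℝ (matVec B.transpose ξ) (gradient g ξ)) := by
  have hpos : ∀ k ≤ r, 0 < lam k := by
    intro k
    induction k with
    | zero => exact fun _ => hlam_zero
    | succ k ih =>
      intro hk
      have h0 := ih (by omega)
      have h1 : 0 < (1 - q k) / lam k + 1 := by
        have := div_nonneg (sub_nonneg.2 (hq k hk).2) h0.le
        linarith
      refine pos_of_mul_pos_left ?_ h1.le
      rw [hlam_rec k hk]
      linarith [hs k hk]
  have hν := hpos r le_rfl
  obtain ⟨c₀, hc₀, hkal⟩ := hkalman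
  have hw : ∀ k, 0 < normalizedWeight lam r k := fun k =>
    div_pos hν (hpos _ (min_le_right _ _))
  have hdiv : ∀ k ≤ r, lam r / normalizedWeight lam r k = lam k := fun k hk => by
    rw [normalizedWeight_of_le hk, div_div_cancel₀ hν.ne']
  have hL : ∀ k ξ, Matrix.toEuclideanCLM (n := Fin n) (𝕜 := ℝ) (Q * B.transpose ^ k)
      (Matrix.toEuclideanCLM (n := Fin n) (𝕜 := ℝ) B.transpose ξ)
      = Matrix.toEuclideanCLM (n := Fin n) (𝕜 := ℝ) (Q * B.transpose ^ (k + 1)) ξ := by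
    intro k ξ
    rw [pow_succ, ← mul_assoc, map_mul _ (Q * B.transpose ^ k)]
    rfl
  obtain ⟨c, C, hc, hC, g, hg, hgc, hgE⟩ := exists_global_multiplier hL hw
    (fun k hk => normalizedWeight_of_ge hpos hk) (monotone_normalizedWeight hpos hlam_decr)
    (antitone_normalizedWeight_sub hpos hlam_decr hlam_ratio) hc₀ hkal (fun j hj => (hq j hj).2)
    hs hν (fun j hj => by
      have h0 := hpos j hj.le
      have h1 := hpos (j + 1) hj
      have := hlam_rec j hj
      rw [normalizedWeight_of_le hj.le, normalizedWeight_of_le hj, ← this]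
      field_simp
      ring) r.zero_le
  refine ⟨c, C, 1, hc, hC, one_pos, g, hg, fun ξ _ => hgc ξ, fun ξ hξ => ?_⟩
  have h := hgE ξ hξ
  rw [zero_add, sum_range_one, hdiv 0 r.zero_le, pow_zero, mul_one] at h
  have hsum : 0 ≤ ∑ k ∈ range r, japaneseBracket (Matrix.toEuclideanCLM (n := Fin n) (𝕜 := ℝ)
      (Q * B.transpose ^ k) ξ) ^ (lam r / normalizedWeight lam r k) :=
    sum_nonneg fun k _ => (Real.rpow_pos_of_pos (japaneseBracket_pos _) _).le
  rw [one_mul, real_inner_comm, gradient, InnerProductSpace.toDual_symm_apply]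
  simp only [toEuclideanCLM_eq_matVec] at h hsum
  linarith
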